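/- Let $\mathcal G$ be the category of finite undirected graphs without multiple edges (loops allowed), with vertex maps preserving edges as morphisms. Let $I_n$ be the graph on $\{0,\dots,n\}$ with $i,j$ adjacent iff $|i-j|\le 1$, and let $\times$ be the categorical product of graphs. Graph maps $f,g:A\to B$ are $\times$-homotopic if for some $n$ there is a graph map $A\times I_n\to B$ restricting to $f$ on $A\times\{0\}$ and to $g$ on $A\times\{n\}$; $f:A\to B$ is a $\times$-homotopy equivalence if there is $g:B\to A$ with $gf$ and $fg$ $\times$-homotopic to the identities. A cofibration category is a category with classes of weak equivalences and of cofibrations, the latter closed under composition, such that: (1) weak equivalences satisfy 2-out-of-6; (2) isomorphisms are acyclic cofibrations (that is, both weak equivalences and cofibrations); (3) there is an initial object; (4) every map from an initial object is a cofibration; (5) pushouts along cofibrations exist, and cofibrations and acyclic cofibrations are preserved under cobase change; (6) every morphism is a cofibration followed by a weak equivalence. A vertex $v$ of a graph folds to a vertex $v'\ne v$ if $N(v)\subseteq N(v')$; the fold removes $v$. A graph is stiff if it has no folds. For an induced subgraph $A$ of $B$, a fold of $v$ to $v'$ is relative if $v\notin V(A)$ and restricted if $v,v'\in V(A)$. An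 inclusion of $A$ as an induced subgraph of $B$ is a quasi-cofibration if $B$ can be folded to a stiff subgraph by a finite sequence of relative and restricted folds such that no other kind of fold is possible at any stage. Theorem. (a) There is no class of cofibrations that makes $\mathcal G$, with the $\times$-homotopy equivalences as weak equivalences, a cofibration category. (b) If a class of cofibrations made $\mathcal G$, with the $\times$-homotopy equivalences as weak equivalences, a cofibration category, then all of its members would be quasi-cofibrations. (By (a) there is no such class.) (c) If $A$ and $B$ are stiff finite graphs with $|V(B)|<|V(A)|$, then no graph map $A\to B$ is a quasi-cofibration followed by a $\times$-homotopy equivalence. (d) In particular, $C_6$ and $K_2$ are stiff, there are graph maps $C_6\to K_2$, and none of them is a quasi-cofibration followed by a $\times$-homotopy equivalence. -/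

import Mathlib

open CategoryTheory CategoryTheory.Limits

/-- A finite undirected graph without multiple edges; loops are allowed. -/
structure FinGraph where
  V : Type
  [finite : Finite V]
  Adj : V → V → Prop
  symm : ∀ {v w : V}, Adj v w → Adj w v

namespace FinGraph

attribute [instance] FinGraph.finite

/-- A graph map: a function on vertices that preserves edges. -/
@[ext]
structure Hom (A B : FinGraph) where
  toFun : A.V → B.V
  map_adj : ∀ {v w : A.V}, A.Adj v w → B.Adj (toFun v) (toFun w)

/-- The category of finite graphs and graph maps. -/
instance : Category FinGraph where
  Hom := Hom
  id A := { toFun := fun v => v, map_adj := fun h => h }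
  comp f g := { toFun := fun v => g.toFun (f.toFun v), map_adj := fun h => g.map_adj (f.map_adj h) }

/-- A simple graph on a finite vertex type, as a finite graph. -/
def ofSimpleGraph {V : Type} [Finite V] (G : SimpleGraph V) : FinGraph where
  V := V
  Adj := G.Adj
  symm := fun h => h.symm

/-- The cycle on six vertices. -/
def C6 : FinGraph := ofSimpleGraph (SimpleGraph.cycleGraph 6)

/-- The complete graph on two vertices. -/
def K2 : FinGraph := ofSimpleGraph (⊤ : SimpleGraph (Fin 2))

/-- The categorical product of two graphs. -/
def prod (G H : FinGraph) : FinGraph where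
  V := G.V × H.V
  Adj := fun p q => G.Adj p.1 q.1 ∧ H.Adj p.2 q.2
  symm := fun h => ⟨G.symm h.1, H.symm h.2⟩

/-- The graph `I n` with vertices `0, …, n`, where `i` and `j` are adjacent iff `|i - j| ≤ 1`;
in particular every vertex is looped. -/
def I (n : ℕ) : FinGraph where
  V := Fin (n + 1)
  Adj := fun i j => |((i : ℕ) : ℤ) - ((j : ℕ) : ℤ)| ≤ 1
  symm := fun {i j} h => by rw [abs_sub_comm]; exact h

/-- Two graph maps `f, g : A ⟶ B` are ×-homotopic if for some `n` there is a graph map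
`A × I n ⟶ B` that restricts to `f` on `A × {0}` and to `g` on `A × {n}`. -/
def XHomotopic {A B : FinGraph} (f g : A ⟶ B) : Prop :=
  ∃ (n : ℕ) (F : A.prod (I n) ⟶ B),
    (∀ a : A.V, F.toFun (a, (0 : Fin (n + 1))) = f.toFun a) ∧
    (∀ a : A.V, F.toFun (a, Fin.last n) = g.toFun a)

/-- The class of ×-homotopy equivalences. -/
def xHomotopyEquivalences : MorphismProperty FinGraph := fun A B f =>
  ∃ g : B ⟶ A, XHomotopic (f ≫ g) (𝟙 A) ∧ XHomotopic (g ≫ f) (𝟙 B)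

/-- The set of neighbours of a vertex (it contains the vertex itself iff that is looped). -/
def neighbors (G : FinGraph) (v : G.V) : Set G.V := {w | G.Adj v w}

/-- In the subgraph of `G` induced on the vertex set `S`, the vertex `v` folds to the other
vertex `v'`: every neighbour of `v` in the subgraph is a neighbour of `v'`. -/
def FoldsIn (G : FinGraph) (S : Set G.V) (v v' : G.V) : Prop :=
  v ∈ S ∧ v' ∈ S ∧ v ≠ v' ∧ G.neighbors v ∩ S ⊆ G.neighbors v' ∩ S

/-- The subgraph of `G` induced on `S` is stiff: it has no folds. -/
def IsStiffOn (G : FinGraph) (S : Set G.V) : Prop := ∀ v v' : G.V, ¬ G.FoldsIn S v v'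

/-- A graph is stiff if it has no folds. -/
def IsStiff (G : FinGraph) : Prop := G.IsStiffOn Set.univ

/-- With respect to the subgraph induced on `A`, the fold of `v` to `v'` is either *relative*
(it fixes `A`, i.e. the vertex `v` that is removed is not in `A`) or *restricted* (it restricts
to a fold of `A`, i.e. both `v` and `v'` are in `A`). -/
def IsRelativeOrRestricted {G : FinGraph} (A : Set G.V) (v v' : G.V) : Prop :=
  v ∉ A ∨ (v ∈ A ∧ v' ∈ A)

/-- The subgraph of `G` induced on `S` can be folded to a stiff subgraph by a sequence of
relative and restricted folds with respect to `A`, such that no other fold is possible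
at any stage. -/
inductive FoldsToStiff (G : FinGraph) (A : Set G.V) : Set G.V → Prop
  | stiff (S : Set G.V) (hS : G.IsStiffOn S) : FoldsToStiff G A S
  | fold (S : Set G.V) (v v' : G.V) (hv : G.FoldsIn S v v')
      (hall : ∀ u u' : G.V, G.FoldsIn S u u' → IsRelativeOrRestricted A u u')
      (hrest : FoldsToStiff G A (S \ {v})) : FoldsToStiff G A S

/-- `f` is an isomorphism onto an induced subgraph. -/
def IsInducedInclusion {A B : FinGraph} (f : A ⟶ B) : Prop :=
  Function.Injective f.toFun ∧ ∀ v w : A.V, B.Adj (f.toFun v) (f.toFun w) → A.Adj v w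

/-- The class of quasi-cofibrations. -/
def quasiCofibrations : MorphismProperty FinGraph := fun _ B f =>
  IsInducedInclusion f ∧ B.FoldsToStiff (Set.range f.toFun) Set.univ

end FinGraph

/-- The class `W` of weak equivalences and the class `Cof` of cofibrations make `C` a
cofibration category. As usual cofibrations are closed under composition (for weak equivalences
this follows from the axioms), and an acyclic cofibration is a morphism in `W ⊓ Cof`. -/
structure IsCofibrationCategory {C : Type*} [Category C] (W Cof : MorphismProperty C) : Prop where
  cof_comp : ∀ {X Y Z : C} (f : X ⟶ Y) (g : Y ⟶ Z), Cof f → Cof g → Cof (f ≫ g)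
  two_of_six : ∀ {X Y Z T : C} (f : X ⟶ Y) (g : Y ⟶ Z) (h : Z ⟶ T),
    W (f ≫ g) → W (g ≫ h) → W f ∧ W g ∧ W h ∧ W (f ≫ g ≫ h)
  iso_acyclic_cof : ∀ {X Y : C} (f : X ⟶ Y), IsIso f → W f ∧ Cof f
  hasInitial : HasInitial C
  cofibrant : ∀ {I : C} (hI : IsInitial I) (X : C), Cof (hI.to X)
  hasPushout : ∀ {X Y Z : C} (i : X ⟶ Y) (f : X ⟶ Z), Cof i → HasPushout i f
  cof_cobaseChange : Cof.IsStableUnderCobaseChange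
  acyclic_cof_cobaseChange : (W ⊓ Cof).IsStableUnderCobaseChange
  factorization : ∀ {X Y : C} (f : X ⟶ Y),
    ∃ (Z : C) (i : X ⟶ Z) (p : Z ⟶ Y), Cof i ∧ W p ∧ i ≫ p = f

/-! Cofibration categories are left proper (`IsCofibrationCategory.weq_inl`), and this fails for
×-homotopy equivalences. Suppose a structure exists, and factor the map from two isolated loops to a
single loop as a cofibration `i` into `Z` followed by a weak equivalence. Let `a`, `b` be the images
of the two loops. Pushing `i` out along the end points of a looped path glues that path to `Z`
between `a` and `b`. Paths are contractible, so by left properness the homotopy type of the result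
does not depend on the length (`xEquiv_gluePath`).

It does depend on it. Fold away vertices of `Z` other than `a`, `b` until none of them folds,
leaving `T`. These folds survive the gluing, and `T` with at least three new path vertices is stiff
(`isStiffOn_withPath`). Homotopy equivalent stiff graphs have equally many vertices
(`XEquiv.card_eq`), but the count grows with the path. This is (a), and (b) is then vacuous.

For (c), no restricted fold can occur when `A` is stiff, so `A` survives in the final stiff graph,
which has as many vertices as `B`. Part (d) is an instance. -/

namespace IsCofibrationCategory

/-! ### Left properness of cofibration categories -/

variable {C : Type*} [Category C] {W Cof : MorphismProperty C}

theorem weq_id (h : IsCofibrationCategory W Cof) (X : C) : W (𝟙 X) :=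
  (h.iso_acyclic_cof (𝟙 X) inferInstance).1

theorem weq_comp (h : IsCofibrationCategory W Cof) {X Y Z : C} {f : X ⟶ Y} {g : Y ⟶ Z}
    (hf : W f) (hg : W g) : W (f ≫ g) := by
  simpa using (h.two_of_six f (𝟙 Y) g (by simpa using hf) (by simpa using hg)).2.2.2

theorem weq_of_comp_right (h : IsCofibrationCategory W Cof) {X Y Z : C} {f : X ⟶ Y} {g : Y ⟶ Z}
    (hg : W g) (hfg : W (f ≫ g)) : W f :=
  (h.two_of_six f g (𝟙 Z) hfg (by simpa using hg)).1

theorem weq_of_comp_left (h : IsCofibrationCategory W Cof) {X Y Z : C} {f : X ⟶ Y} {g : Y ⟶ Z}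
    (hf : W f) (hfg : W (f ≫ g)) : W g :=
  (h.two_of_six (𝟙 X) f g (by simpa using hf) hfg).2.2.1

theorem cof_inl (h : IsCofibrationCategory W Cof) {X Y Z P : C} {i : X ⟶ Y} {f : X ⟶ Z}
    {g : Y ⟶ P} {j : Z ⟶ P} (sq : IsPushout i f g j) (hf : Cof f) : Cof g :=
  h.cof_cobaseChange.of_isPushout sq hf

theorem cof_inr (h : IsCofibrationCategory W Cof) {X Y Z P : C} {i : X ⟶ Y} {f : X ⟶ Z}
    {g : Y ⟶ P} {j : Z ⟶ P} (sq : IsPushout i f g j) (hi : Cof i) : Cof j :=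
  h.cof_cobaseChange.of_isPushout sq.flip hi

theorem weq_inr (h : IsCofibrationCategory W Cof) {X Y Z P : C} {i : X ⟶ Y} {f : X ⟶ Z}
    {g : Y ⟶ P} {j : Z ⟶ P} (sq : IsPushout i f g j) (hi : Cof i) (hW : W i) : W j :=
  (h.acyclic_cof_cobaseChange.of_isPushout sq.flip ⟨hW, hi⟩).1

/-- Brown's factorization of a morphism `φ` between cofibrant objects under `A`. -/
theorem exists_brown_factorization (h : IsCofibrationCategory W Cof) {A X Y : C} {u : A ⟶ X}
    {v : A ⟶ Y} (hu : Cof u) (hv : Cof v) (φ : X ⟶ Y) (w : u ≫ φ = v) :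
    ∃ (Z : C) (j : X ⟶ Z) (s : Y ⟶ Z) (p : Z ⟶ Y), Cof j ∧ Cof s ∧ W p ∧ j ≫ p = φ ∧
      s ≫ p = 𝟙 Y ∧ u ≫ j = v ≫ s := by
  have := h.hasPushout u v hu
  have sq := IsPushout.of_hasPushout u v
  obtain ⟨Z, q, p, hq, hp, e⟩ := h.factorization (sq.desc φ (𝟙 Y) (by simpa using w))
  refine ⟨Z, pushout.inl u v ≫ q, pushout.inr u v ≫ q, p,
    h.cof_comp _ _ (h.cof_inl sq hv) hq, h.cof_comp _ _ (h.cof_inr sq hu) hq, hp, ?_, ?_, ?_⟩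
  · rw [Category.assoc, e, sq.inl_desc]
  · rw [Category.assoc, e, sq.inr_desc]
  · rw [← Category.assoc, ← Category.assoc, sq.w]

/-- Cobase change along any morphism preserves weak equivalences between cofibrations. -/
theorem weq_cobaseChange_under (h : IsCofibrationCategory W Cof) {A B X Y P Q : C} {u : A ⟶ X}
    {v : A ⟶ Y} (hu : Cof u) (hv : Cof v) {φ : X ⟶ Y} (w : u ≫ φ = v) (hφ : W φ) {c : A ⟶ B}
    {g₁ : X ⟶ P} {j₁ : B ⟶ P} {g₂ : Y ⟶ Q} {j₂ : B ⟶ Q} (sq₁ : IsPushout u c g₁ j₁)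
    (sq₂ : IsPushout v c g₂ j₂) {ψ : P ⟶ Q} (hg : g₁ ≫ ψ = φ ≫ g₂) (hj : j₁ ≫ ψ = j₂) :
    W ψ := by
  obtain ⟨Z, j, s, p, cj, cs, hp, jp, sp, e⟩ := h.exists_brown_factorization hu hv φ w
  -- Both `j` and `s` are acyclic cofibrations under `A`; after cobase change along `c` they become
  -- pushouts of acyclic cofibrations (`t₁`, `t₂`).
  have hWj : W j := h.weq_of_comp_right hp (jp ▸ hφ)
  have hWs : W s := h.weq_of_comp_right hp (sp ▸ h.weq_id Y)
  have := h.hasPushout (u ≫ j) c (h.cof_comp _ _ hu cj)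
  have sq := IsPushout.of_hasPushout (u ≫ j) c
  set g := pushout.inl (u ≫ j) c
  set k := pushout.inr (u ≫ j) c
  have w₁ : u ≫ (j ≫ g) = c ≫ k := by rw [← Category.assoc, sq.w]
  have w₂ : v ≫ (s ≫ g) = c ≫ k := by rw [← Category.assoc, ← e, sq.w]
  have t₁ : IsPushout j g₁ g (sq₁.desc (j ≫ g) k w₁) := by
    refine IsPushout.of_left (h₁₁ := u) (h₂₁ := j₁) (v₁₁ := c) ?_ ?_ sq₁
    · simpa using sq
    · simp
  have t₂ : IsPushout s g₂ g (sq₂.desc (s ≫ g) k w₂) := by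
    refine IsPushout.of_left (h₁₁ := v) (h₂₁ := j₂) (v₁₁ := c) ?_ ?_ sq₂
    · simpa [← e] using sq
    · simp
  have hW₁ := h.weq_inr t₁ cj hWj
  have hW₂ := h.weq_inr t₂ cs hWs
  have w₃ : (u ≫ j) ≫ (p ≫ g₂) = c ≫ j₂ := by
    rw [Category.assoc, ← Category.assoc j, jp, ← Category.assoc, w, sq₂.w]
  -- The map induced by `p` retracts a weak equivalence, hence is one; `ψ` factors through it by
  -- `hd`.
  have hr : sq₂.desc (s ≫ g) k w₂ ≫ sq.desc (p ≫ g₂) j₂ w₃ = 𝟙 Q := by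
    apply sq₂.hom_ext
    · simp only [IsPushout.inl_desc_assoc, Category.assoc, IsPushout.inl_desc, Category.comp_id]
      rw [← Category.assoc, sp, Category.id_comp]
    · simp
  have hd : sq₁.desc (j ≫ g) k w₁ ≫ sq.desc (p ≫ g₂) j₂ w₃ = ψ := by
    apply sq₁.hom_ext
    · simp only [IsPushout.inl_desc_assoc, Category.assoc, IsPushout.inl_desc]
      rw [← Category.assoc, jp, hg]
    · simp [hj]
  rw [← hd]
  exact h.weq_comp hW₁ (h.weq_of_comp_left hW₂ (hr ▸ h.weq_id Q))

/-- Left properness for a weak equivalence with a section that is an acyclic cofibration. -/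
theorem weq_inl_of_section (h : IsCofibrationCategory W Cof) {Z B Y Q : C} {u : Z ⟶ Y}
    (hu : Cof u) {p : Z ⟶ B} {s : B ⟶ Z} (hs : Cof s) (hWs : W s) (sp : s ≫ p = 𝟙 B)
    {g : Y ⟶ Q} {j : B ⟶ Q} (sq : IsPushout u p g j) : W g := by
  have hsu := h.cof_comp _ _ hs hu
  -- Gluing `Z` and `Y` along `B` gives an object weakly equivalent to `Y` under `Z`, but whose
  -- cobase change along `p` is `Y` itself. Cobase change of this equivalence along `p` is `g`.
  have := h.hasPushout s (s ≫ u) hs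
  have t := IsPushout.of_hasPushout s (s ≫ u)
  set a := pushout.inl s (s ≫ u)
  set b := pushout.inr s (s ≫ u)
  have ha : Cof a := h.cof_inl t hsu
  have hb : W b := h.weq_inr t hs hWs
  have wφ : s ≫ u = (s ≫ u) ≫ 𝟙 Y := by simp
  have hφ : W (t.desc u (𝟙 Y) wφ) :=
    h.weq_of_comp_left hb (by simpa using h.weq_id Y)
  -- The pushout of `a` along `p` is `Y`, since that of `s ≫ u` along `s ≫ p = 𝟙` is.
  have hr : s ≫ (p ≫ s ≫ u) = (s ≫ u) ≫ 𝟙 Y := by rw [← Category.assoc, sp]; simp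
  have sq₁ : IsPushout a p (t.desc (p ≫ s ≫ u) (𝟙 Y) hr) (s ≫ u) := by
    have big : IsPushout (s ≫ p) (s ≫ u) (s ≫ u) (b ≫ t.desc (p ≫ s ≫ u) (𝟙 Y) hr) := by
      rw [sp, t.inr_desc]
      exact IsPushout.of_horiz_isIso ⟨by simp⟩
    exact (IsPushout.of_left big (by simp) t).flip
  have hψ : W (g : Y ⟶ Q) := by
    refine h.weq_cobaseChange_under ha hu (φ := t.desc u (𝟙 Y) wφ) (by simp [a]) hφ sq₁ sq
      ?_ ?_
    · apply t.hom_ext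
      · simp only [IsPushout.inl_desc_assoc, Category.assoc]
        rw [sq.w, ← Category.assoc s p, sp, Category.id_comp]
      · simp
    · rw [Category.assoc, sq.w, ← Category.assoc, sp, Category.id_comp]
  exact hψ

/-- Cofibration categories are left proper. -/
theorem weq_inl (h : IsCofibrationCategory W Cof) {A B Y Q : C} {i : A ⟶ Y} (hi : Cof i)
    {f : A ⟶ B} (hf : W f) {g : Y ⟶ Q} {j : B ⟶ Q} (sq : IsPushout i f g j) : W g := by
  have := h.hasInitial
  obtain ⟨Z, k, s, p, ck, cs, hp, kp, sp, -⟩ := h.exists_brown_factorization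
    (h.cofibrant initialIsInitial A) (h.cofibrant initialIsInitial B) f
    (initialIsInitial.hom_ext _ _)
  have hWk : W k := h.weq_of_comp_right hp (kp ▸ hf)
  have hWs : W s := h.weq_of_comp_right hp (sp ▸ h.weq_id B)
  have := h.hasPushout i k hi
  have t := IsPushout.of_hasPushout i k
  have w : i ≫ g = k ≫ p ≫ j := by rw [← Category.assoc, kp, sq.w]
  -- The pushout along `f = k ≫ p` is done in two stages: `k` is an acyclic cofibration, and `p` has
  -- the section `s`.
  have sq' : IsPushout (pushout.inr i k) p (t.desc g (p ≫ j) w) j := by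
    refine (IsPushout.of_left (h₁₁ := k) (h₂₁ := pushout.inl i k) (v₁₁ := i) ?_ ?_ t.flip).flip
    · rw [kp, t.inl_desc]
      exact sq.flip
    · simp
  have h₁ : W (pushout.inl i k) := h.weq_inr t.flip ck hWk
  have h₂ := h.weq_inl_of_section (h.cof_inr t hi) cs hWs sp sq'
  rw [← t.inl_desc g (p ≫ j) w]
  exact h.weq_comp h₁ h₂

end IsCofibrationCategory

namespace FinGraph

/-! ### ×-homotopies as chains of steps -/

@[simp]
theorem id_toFun {A : FinGraph} (v : A.V) : Hom.toFun (𝟙 A) v = v := rfl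

@[simp]
theorem comp_toFun {A B C : FinGraph} (f : A ⟶ B) (g : B ⟶ C) (v : A.V) :
    Hom.toFun (f ≫ g) v = g.toFun (f.toFun v) := rfl

theorem hom_ext {A B : FinGraph} {f g : A ⟶ B} (h : ∀ v, f.toFun v = g.toFun v) : f = g :=
  Hom.ext (funext h)

/-- Two graph maps are one step apart if they are the ends of a ×-homotopy of length one. -/
def Step {A B : FinGraph} (f g : A ⟶ B) : Prop :=
  ∀ v w : A.V, A.Adj v w → B.Adj (f.toFun v) (g.toFun w)

theorem Step.symm {A B : FinGraph} {f g : A ⟶ B} (h : Step f g) : Step g f :=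
  fun v w hvw => B.symm (h w v (A.symm hvw))

/-- The level `k` of a ×-homotopy. -/
def level {A B : FinGraph} {n : ℕ} (F : A.prod (I n) ⟶ B) (k : Fin (n + 1)) : A ⟶ B where
  toFun := fun v => F.toFun (v, k)
  map_adj := fun h => F.map_adj ⟨h, show |((k : ℕ) : ℤ) - ((k : ℕ) : ℤ)| ≤ 1 by simp⟩

/-- Since the vertices of `I n` are looped, each level of a homotopy is a graph map, and consecutive
levels are one step apart. This replaces homotopies by chains, on which induction is possible. -/
theorem xHomotopic_iff {A B : FinGraph} {f g : A ⟶ B} :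
    XHomotopic f g ↔ Relation.ReflTransGen Step f g := by
  constructor
  · rintro ⟨n, F, h0, hn⟩
    have key : ∀ k : ℕ, ∀ hk : k < n + 1,
        Relation.ReflTransGen Step (level F 0) (level F ⟨k, hk⟩) := by
      intro k
      induction k with
      | zero => exact fun _ => .refl
      | succ k ih =>
        intro hk
        refine (ih (by omega)).tail fun v w hvw => F.map_adj ⟨hvw, ?_⟩
        change |((k : ℕ) : ℤ) - ((k + 1 : ℕ) : ℤ)| ≤ 1
        simp
    have e0 : level F 0 = f := hom_ext h0
    have en : level F (Fin.last n) = g := hom_ext hn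
    rw [← e0, ← en]
    exact key n (by omega)
  · intro h
    induction h with
    | refl =>
      exact ⟨0, { toFun := fun p => f.toFun p.1, map_adj := fun h => f.map_adj h.1 },
        fun _ => rfl, fun _ => rfl⟩
    | @tail g g' _ hs ih =>
      obtain ⟨n, F, h0, hn⟩ := ih
      -- `F` on the levels up to `n`, and `g'` on the new level `n + 1`.
      let G : A.V × Fin (n + 2) → B.V := fun p =>
        if h : (p.2 : ℕ) < n + 1 then F.toFun (p.1, (⟨p.2, h⟩ : Fin (n + 1))) else g'.toFun p.1
      have hG : ∀ p q : A.V × Fin (n + 2), A.Adj p.1 q.1 →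
          |((p.2 : ℕ) : ℤ) - ((q.2 : ℕ) : ℤ)| ≤ 1 → (p.2 : ℕ) ≤ q.2 →
          B.Adj (G p) (G q) := by
        rintro ⟨v, k, hk⟩ ⟨w, l, hl⟩ hvw hkl hle
        simp only [abs_le] at hkl hle
        by_cases h2 : l < n + 1
        · have h1 : k < n + 1 := by omega
          simp only [G, h1, h2, dif_pos]
          refine F.map_adj ⟨hvw, ?_⟩
          change |((k : ℕ) : ℤ) - ((l : ℕ) : ℤ)| ≤ 1
          rw [abs_le]
          exact hkl
        · by_cases h1 : k < n + 1
          · obtain rfl : k = n := by omega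
            simp only [G, h1, h2, dif_pos, dif_neg, not_false_eq_true]
            have := hn v
            rw [show (⟨k, h1⟩ : Fin (k + 1)) = Fin.last k from rfl, this]
            exact hs v w hvw
          · simp only [G, h1, h2, dif_neg, not_false_eq_true]
            exact g'.map_adj hvw
      refine ⟨n + 1, { toFun := G, map_adj := ?_ }, ?_, ?_⟩
      · rintro p q ⟨hpq, hI⟩
        obtain ⟨v, k⟩ := p
        obtain ⟨w, l⟩ := q
        rcases le_total (Fin.val (n := n + 2) k) (Fin.val (n := n + 2) l) with h | h
        · exact hG (v, k) (w, l) hpq hI h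
        · refine B.symm (hG (w, l) (v, k) (A.symm hpq) ?_ h)
          rw [abs_sub_comm]
          exact hI
      · intro a
        exact h0 a
      · intro a
        simp [G]

theorem xHomotopic_equivalence (A B : FinGraph) :
    Equivalence (XHomotopic : (A ⟶ B) → (A ⟶ B) → Prop) where
  refl f := xHomotopic_iff.2 .refl
  symm h := by
    rw [xHomotopic_iff] at h ⊢
    have : Std.Symm (Step : (A ⟶ B) → (A ⟶ B) → Prop) := ⟨fun _ _ h => h.symm⟩
    exact Std.Symm.symm _ _ h
  trans h k := by
    rw [xHomotopic_iff] at h k ⊢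
    exact h.trans k

theorem XHomotopic.comp_left {A B C : FinGraph} {g g' : B ⟶ C} (h : XHomotopic g g')
    (f : A ⟶ B) : XHomotopic (f ≫ g) (f ≫ g') := by
  rw [xHomotopic_iff] at h ⊢
  exact h.lift (f ≫ ·) fun g g' (hs : Step g g') v w hvw => hs _ _ (f.map_adj hvw)

theorem XHomotopic.comp_right {A B C : FinGraph} {f f' : A ⟶ B} (h : XHomotopic f f')
    (g : B ⟶ C) : XHomotopic (f ≫ g) (f' ≫ g) := by
  rw [xHomotopic_iff] at h ⊢
  exact h.lift (· ≫ g) fun f f' (hs : Step f f') v w hvw => g.map_adj (hs v w hvw)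

/-- Two graphs are ×-homotopy equivalent if there is a ×-homotopy equivalence between them. -/
def XEquiv (A B : FinGraph) : Prop := ∃ f : A ⟶ B, xHomotopyEquivalences f

theorem XEquiv.symm {A B : FinGraph} : XEquiv A B → XEquiv B A
  | ⟨f, g, h, k⟩ => ⟨g, f, k, h⟩

theorem XEquiv.trans {A B C : FinGraph} : XEquiv A B → XEquiv B C → XEquiv A C := by
  rintro ⟨f, g, h, k⟩ ⟨f', g', h', k'⟩
  refine ⟨f ≫ f', g' ≫ g, ?_, ?_⟩
  · have := ((h'.comp_right g).comp_left f)
    simp only [Category.assoc, Category.id_comp] at this ⊢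
    exact (xHomotopic_equivalence _ _).trans this h
  · have := ((k.comp_right f').comp_left g')
    simp only [Category.assoc, Category.id_comp] at this ⊢
    exact (xHomotopic_equivalence _ _).trans this k'

/-! ### Stiff graphs and folds -/

theorem isStiff_iff {A : FinGraph} :
    A.IsStiff ↔ ∀ v v' : A.V, A.neighbors v ⊆ A.neighbors v' → v = v' := by
  simp only [IsStiff, IsStiffOn, FoldsIn, Set.inter_univ, Set.mem_univ, true_and, not_and]
  exact forall₂_congr fun v v' => not_imp_not

/-- A map from a stiff graph to itself that is ×-homotopic to the identity is the identity. -/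
theorem IsStiff.eq_id {A : FinGraph} (hA : A.IsStiff) {f : A ⟶ A} (h : XHomotopic f (𝟙 A)) :
    f = 𝟙 A := by
  rw [xHomotopic_iff] at h
  induction h using Relation.ReflTransGen.head_induction_on with
  | refl => rfl
  | head hs _ ih =>
    subst ih
    -- One step from the identity means that every neighbour of `v` is a neighbour of its image.
    exact hom_ext fun v => (isStiff_iff.1 hA _ _ fun w hw => hs v w hw).symm

theorem XEquiv.card_eq {A B : FinGraph} (h : XEquiv A B) (hA : A.IsStiff) (hB : B.IsStiff) :
    Nat.card A.V = Nat.card B.V := by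
  obtain ⟨f, g, h, k⟩ := h
  have h := hA.eq_id h
  have k := hB.eq_id k
  exact Nat.card_congr ⟨f.toFun, g.toFun, fun v => congrArg (fun q : A ⟶ A => q.toFun v) h,
    fun v => congrArg (fun q : B ⟶ B => q.toFun v) k⟩

/-- The subgraph of `G` induced on `S`. -/
def induce (G : FinGraph) (S : Set G.V) : FinGraph where
  V := S
  Adj := fun v w => G.Adj v w
  symm := fun h => G.symm h

theorem isStiff_induce {G : FinGraph} {S : Set G.V} (h : G.IsStiffOn S) : (G.induce S).IsStiff := by
  rw [isStiff_iff]
  intro v v' hvv'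
  by_contra hne
  exact h v.1 v'.1 ⟨v.2, v'.2, fun e => hne (Subtype.ext e), fun w hw => ⟨@hvv' ⟨w, hw.2⟩ hw.1, hw.2⟩⟩

theorem xEquiv_induce_univ (G : FinGraph) : XEquiv G (G.induce Set.univ) :=
  ⟨{ toFun := fun v => ⟨v, trivial⟩, map_adj := fun h => h },
    { toFun := fun v => v.1, map_adj := fun h => h },
    (xHomotopic_equivalence _ _).refl _, (xHomotopic_equivalence _ _).refl _⟩

-- The retraction `r` sending `v` to `v'` is one step away from the identity, which is what `hr`
-- expresses.
open Classical in
theorem FoldsIn.xEquiv {G : FinGraph} {S : Set G.V} {v v' : G.V} (h : G.FoldsIn S v v') :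
    XEquiv (G.induce S) (G.induce (S \ {v})) := by
  obtain ⟨hv, hv', hne, hN⟩ := h
  let r : G.V → G.V := fun x => if x = v then v' else x
  have hr : ∀ x y, x ∈ S → y ∈ S → G.Adj x y → G.Adj (r x) y := by
    intro x y _ hy hxy
    by_cases hx : x = v
    · subst hx
      simpa [r, neighbors] using (hN ⟨hxy, hy⟩).1
    · simpa [r, hx] using hxy
  have hrS : ∀ x, x ∈ S → r x ∈ S \ {v} := by
    intro x hx
    by_cases hxv : x = v
    · simpa [r, hxv] using ⟨hv', hne.symm⟩
    · simpa [r, hxv] using hx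
  refine ⟨{ toFun := fun x => ⟨r x.1, hrS _ x.2⟩, map_adj := ?_ },
    { toFun := fun x => ⟨x.1, x.2.1⟩, map_adj := fun h => h }, ?_, ?_⟩
  · intro x y hxy
    exact G.symm (hr _ _ y.2 (hrS _ x.2).1 (G.symm (hr _ _ x.2 y.2 hxy)))
  · exact xHomotopic_iff.2 (.single fun x y hxy => hr _ _ x.2 y.2 hxy)
  · refine xHomotopic_iff.2 (.single fun x y hxy => hr _ _ x.2.1 y.2.1 hxy)

/-! ### Quasi-cofibrations out of stiff graphs -/

/-- If the subgraph induced on `A` is stiff, all folds in a folding sequence are relative. -/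
theorem FoldsToStiff.exists_stiff {G : FinGraph} {A S : Set G.V} (h : G.FoldsToStiff A S)
    (hA : G.IsStiffOn A) (hAS : A ⊆ S) :
    ∃ T, A ⊆ T ∧ G.IsStiffOn T ∧ XEquiv (G.induce S) (G.induce T) := by
  induction h with
  | stiff S hS =>
    exact ⟨S, hAS, hS, 𝟙 _, 𝟙 _, by simpa using (xHomotopic_equivalence _ _).refl _,
      by simpa using (xHomotopic_equivalence _ _).refl _⟩
  | fold S v v' hv hall _ ih =>
    -- A restricted fold in `S` would also be a fold in the subgraph induced on `A`.
    have hvA : v ∉ A := by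
      rcases hall v v' hv with h | ⟨h, h'⟩
      · exact h
      · exact absurd ⟨h, h', hv.2.2.1, fun w hw => ⟨(hv.2.2.2 ⟨hw.1, hAS hw.2⟩).1, hw.2⟩⟩ (hA v v')
    obtain ⟨T, h1, h2, h3⟩ := ih fun x hx => ⟨hAS hx, fun e => hvA (e ▸ hx)⟩
    exact ⟨T, h1, h2, hv.xEquiv.trans h3⟩

theorem IsInducedInclusion.isStiffOn_range {A B : FinGraph} {f : A ⟶ B}
    (hf : IsInducedInclusion f) (hA : A.IsStiff) : B.IsStiffOn (Set.range f.toFun) := by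
  rintro _ _ ⟨⟨v, rfl⟩, ⟨v', rfl⟩, hne, hN⟩
  refine hne (congrArg _ (isStiff_iff.1 hA v v' fun w hw => ?_))
  exact hf.2 _ _ (hN ⟨f.map_adj hw, w, rfl⟩).1

theorem not_exists_quasiCofibration_factorization {A B : FinGraph} (hA : A.IsStiff)
    (hB : B.IsStiff) (hcard : Nat.card B.V < Nat.card A.V) (h : A ⟶ B) :
    ¬ ∃ (B' : FinGraph) (f : A ⟶ B') (g : B' ⟶ B),
      quasiCofibrations f ∧ xHomotopyEquivalences g ∧ f ≫ g = h := by
  rintro ⟨B', f, g, ⟨hf, hfold⟩, hg, -⟩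
  obtain ⟨T, hT, hTs, hTe⟩ := hfold.exists_stiff (hf.isStiffOn_range hA) (Set.subset_univ _)
  have e : XEquiv (B'.induce T) B :=
    ((xEquiv_induce_univ B').trans hTe).symm.trans ⟨g, hg⟩
  have hc := e.card_eq (isStiff_induce hTs) hB
  have : Nat.card A.V ≤ Nat.card T :=
    Nat.card_le_card_of_injective (fun v => (⟨f.toFun v, hT ⟨v, rfl⟩⟩ : T))
      fun v w hvw => hf.1 (congrArg Subtype.val hvw)
  have h' : Nat.card (B'.induce T).V = Nat.card T := rfl
  omega

theorem isStiff_C6 : C6.IsStiff := by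
  rw [isStiff_iff]
  have h : ∀ v v' : Fin 6, (∀ w, (SimpleGraph.cycleGraph 6).Adj v w →
      (SimpleGraph.cycleGraph 6).Adj v' w) → v = v' := by decide
  exact fun v v' hvv' => h v v' fun w hw => hvv' hw

theorem isStiff_K2 : K2.IsStiff := by
  rw [isStiff_iff]
  have h : ∀ v v' : Fin 2, (∀ w, (⊤ : SimpleGraph (Fin 2)).Adj v w →
      (⊤ : SimpleGraph (Fin 2)).Adj v' w) → v = v' := by decide
  exact fun v v' hvv' => h v v' fun w hw => hvv' hw

theorem nonempty_hom_C6_K2 : Nonempty (C6 ⟶ K2) := by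
  have h : ∀ v w : Fin 6, (SimpleGraph.cycleGraph 6).Adj v w →
      (⊤ : SimpleGraph (Fin 2)).Adj (Fin.ofNat 2 v.val) (Fin.ofNat 2 w.val) := by decide
  exact ⟨{ toFun := fun v : Fin 6 => (Fin.ofNat 2 v.val : Fin 2), map_adj := fun {v w} => h v w }⟩

/-! ### Gluing a path, and stiffness of the result -/

/-- The graph `Z` with a path of `m` looped new vertices glued between the vertices `a` and `b`. -/
abbrev gluePath (Z : FinGraph) (a b : Z.V) (m : ℕ) : FinGraph where
  V := Z.V ⊕ Fin m
  Adj := fun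
    | .inl x, .inl y => Z.Adj x y
    | .inl x, .inr j => (x = a ∧ (j : ℕ) = 0) ∨ (x = b ∧ (j : ℕ) + 1 = m)
    | .inr j, .inl x => (x = a ∧ (j : ℕ) = 0) ∨ (x = b ∧ (j : ℕ) + 1 = m)
    | .inr j, .inr k => (j : ℕ) ≤ k + 1 ∧ (k : ℕ) ≤ j + 1
  symm := by
    rintro (x | j) (y | k) h
    · exact Z.symm h
    · exact h
    · exact h
    · exact ⟨h.2, h.1⟩

section gluePath

variable {Z : FinGraph} {a b : Z.V} {m : ℕ}

/-- The vertices of `gluePath Z a b m` that lie in `S` or on the path. -/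
def withPath (S : Set Z.V) (m : ℕ) : Set (Z.V ⊕ Fin m) := {v | ∀ z, v = .inl z → z ∈ S}

@[simp]
theorem inl_mem_withPath {S : Set Z.V} {z : Z.V} : Sum.inl z ∈ withPath S m ↔ z ∈ S := by
  simp [withPath]

@[simp]
theorem inr_mem_withPath {S : Set Z.V} {j : Fin m} : Sum.inr j ∈ withPath S m := by
  simp [withPath]

theorem card_withPath (S : Set Z.V) (m : ℕ) : Nat.card (withPath S m) = Nat.card S + m := by
  have e : withPath S m ≃ S ⊕ Fin m :=
    { toFun := fun v => match v with
        | ⟨.inl z, h⟩ => .inl ⟨z, by simpa using h⟩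
        | ⟨.inr j, _⟩ => .inr j
      invFun := fun v => match v with
        | .inl z => ⟨.inl z.1, by simp⟩
        | .inr j => ⟨.inr j, by simp⟩
      left_inv := by rintro ⟨_ | _, _⟩ <;> rfl
      right_inv := by rintro (_ | _) <;> rfl }
  rw [Nat.card_congr e, Nat.card_sum, Nat.card_fin]

/-- One removes from `S` a vertex outside of `K` that can be folded. -/
def FoldStepRel (K S S' : Set Z.V) : Prop := ∃ v v', v ∉ K ∧ Z.FoldsIn S v v' ∧ S' = S \ {v}

theorem exists_reduction (K S : Set Z.V) (hKS : K ⊆ S) :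
    ∃ T, K ⊆ T ∧ Relation.ReflTransGen (FoldStepRel K) S T ∧
      ∀ v v', v ∉ K → ¬ Z.FoldsIn T v v' := by
  induction hn : S.ncard using Nat.strong_induction_on generalizing S with
  | _ n ih =>
    by_cases h : ∀ v v', v ∉ K → ¬ Z.FoldsIn S v v'
    · exact ⟨S, hKS, .refl, h⟩
    · push Not at h
      obtain ⟨v, v', hv, hf⟩ := h
      obtain ⟨T, h₁, h₂, h₃⟩ := ih (S \ {v}).ncard
        (hn ▸ Set.ncard_sdiff_singleton_lt_of_mem hf.1 S.toFinite) (S \ {v})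
        (fun x hx => ⟨hKS hx, fun e => hv (e ▸ hx)⟩) rfl
      exact ⟨T, h₁, h₂.head ⟨v, v', hv, hf, rfl⟩, h₃⟩

theorem FoldStepRel.xEquiv {K S T : Set Z.V} (h : Relation.ReflTransGen (FoldStepRel K) S T) :
    XEquiv (Z.induce S) (Z.induce T) := by
  induction h with
  | refl => exact ⟨𝟙 _, 𝟙 _, (xHomotopic_equivalence _ _).refl _, (xHomotopic_equivalence _ _).refl _⟩
  | tail _ hs ih =>
    obtain ⟨v, v', -, hf, rfl⟩ := hs
    exact ih.trans hf.xEquiv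

/-- The path meets `Z` only at `a` and `b`, so the folded vertex gains no neighbours. -/
theorem FoldStepRel.withPath {S S' : Set Z.V} (h : FoldStepRel {a, b} S S') (m : ℕ) :
    FoldStepRel (Z := Z.gluePath a b m) {.inl a, .inl b} (withPath S m) (withPath S' m) := by
  obtain ⟨v, v', hv, ⟨hvS, hvS', hne, hN⟩, rfl⟩ := h
  simp only [Set.mem_insert_iff, Set.mem_singleton_iff, not_or] at hv
  refine ⟨.inl v, .inl v', by simpa using hv, ⟨by simpa using hvS, by simpa using hvS',
    by simpa using hne, ?_⟩, ?_⟩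
  · rintro (x | j) ⟨hx, hxS⟩
    · exact ⟨(hN ⟨hx, by simpa using hxS⟩).1, hxS⟩
    · have hx : (v = a ∧ _) ∨ (v = b ∧ _) := hx
      tauto
  · ext (x | j)
    · simp only [inl_mem_withPath, Set.mem_sdiff, Set.mem_singleton_iff]
      simp
    · simp only [inr_mem_withPath, Set.mem_sdiff, Set.mem_singleton_iff]
      simp

/-- The neighbours `c` prevent `a` and `b` from folding onto the path when they differ; when `a =
b`, its path neighbours are too far apart. The bound `3 ≤ m` keeps both ends of the path at distance
at least two. -/
theorem isStiffOn_withPath {T : Set Z.V} (hm : 3 ≤ m) (haT : a ∈ T) (hbT : b ∈ T)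
    (ha : Z.Adj a a) (hb : Z.Adj b b) (hT : ∀ v v', v ∉ ({a, b} : Set Z.V) → ¬ Z.FoldsIn T v v')
    (hac : a = b ∨ ∃ c ∈ T, c ≠ a ∧ Z.Adj a c) (hbc : a = b ∨ ∃ c ∈ T, c ≠ b ∧ Z.Adj b c) :
    (Z.gluePath a b m).IsStiffOn (withPath T m) := by
  rintro u u' ⟨hu, hu', hne, hN⟩
  have hN : ∀ w, w ∈ withPath T m → (Z.gluePath a b m).Adj u w → (Z.gluePath a b m).Adj u' w :=
    fun w hw h => (hN ⟨h, hw⟩).1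
  have hNl : ∀ w ∈ T, (Z.gluePath a b m).Adj u (.inl w) → (Z.gluePath a b m).Adj u' (.inl w) :=
    fun w hw => hN _ (by simpa using hw)
  have hNr : ∀ j : ℕ, ∀ hj : j < m, (Z.gluePath a b m).Adj u (.inr ⟨j, hj⟩) →
      (Z.gluePath a b m).Adj u' (.inr ⟨j, hj⟩) := fun j hj => hN _ (by simp)
  clear hN
  rcases u with t | ⟨j, hj⟩
  · simp only [inl_mem_withPath] at hu
    simp only at hNl hNr
    by_cases hta : t = a
    · subst hta
      have h1 := hNr 0 (by omega) (by simp)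
      have h2 := hNl t haT ha
      rcases u' with x | ⟨k, hk⟩
      · simp only at h1
        rcases h1 with h1 | h1
        · exact hne (by rw [h1.1])
        · omega
      · simp only at h1 h2 hNl hNr
        rcases hac with rfl | ⟨c, hc, hct, hadj⟩
        · have h3 := hNr (m - 1) (by omega) (by simp; omega)
          have := hNr 0 (by omega) (by simp)
          omega
        · have h3 := hNl c hc hadj
          simp only [hct, false_and, false_or] at h3
          omega
    · by_cases htb : t = b
      · subst htb
        have h1 := hNr (m - 1) (by omega) (by right; simp; omega)
        have h2 := hNl t hbT hb
        rcases u' with x | ⟨k, hk⟩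
        · simp only at h1
          rcases h1 with h1 | h1
          · omega
          · exact hne (by rw [h1.1])
        · simp only at h1 h2 hNl hNr
          rcases hbc with rfl | ⟨c, hc, hct, hadj⟩
          · exact hta rfl
          · have h3 := hNl c hc hadj
            simp only [hct, false_and, or_false] at h3
            omega
      · have hK : t ∉ ({a, b} : Set Z.V) := by simp [hta, htb]
        rcases u' with x | ⟨k, hk⟩
        · exact hT t x hK ⟨hu, by simpa using hu', fun e => hne (by rw [e]),
            fun w hw => ⟨hNl w hw.2 hw.1, hw.2⟩⟩
        · simp only at hNl
          -- A path vertex has at most one neighbour in `Z`, namely `a` or `b`. As these are looped,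
          -- a fold of `t` onto the path yields a fold of `t` to `a` or `b` inside `T`.
          by_cases hk0 : k = 0
          · refine hT t a hK ⟨hu, haT, hta, fun w hw => ⟨?_, hw.2⟩⟩
            rcases hNl w hw.2 hw.1 with h | h
            · exact h.1 ▸ ha
            · omega
          · refine hT t b hK ⟨hu, hbT, htb, fun w hw => ⟨?_, hw.2⟩⟩
            rcases hNl w hw.2 hw.1 with h | h
            · omega
            · exact h.1 ▸ hb
  · have h0 := hNr j hj (by simp)
    have hp : ∀ h : j ≠ 0, (Z.gluePath a b m).Adj u' (.inr ⟨j - 1, by omega⟩) := fun h =>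
      hNr (j - 1) (by omega) (by simp; omega)
    have hq : ∀ h : j + 1 ≠ m, (Z.gluePath a b m).Adj u' (.inr ⟨j + 1, by omega⟩) := fun h =>
      hNr (j + 1) (by omega) (by simp; omega)
    -- A vertex of `Z` sees only the ends of the path, never two consecutive path vertices; and on
    -- the path the neighbours of `j` determine `j`.
    rcases u' with x | ⟨k, hk⟩
    · simp only at h0 hp hq
      omega
    · have hpa : j = 0 → (Z.gluePath a b m).Adj (.inr ⟨k, hk⟩) (.inl a) := fun h => hNl a haT (by simp [h])
      have hqb : j + 1 = m → (Z.gluePath a b m).Adj (.inr ⟨k, hk⟩) (.inl b) := fun h => hNl b hbT (by simp [h])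
      simp only at h0 hp hq hpa hqb
      have hjk : j ≠ k := fun e => hne (by simp [e])
      omega

/-- The path in `gluePath Z a b m` from `a` to `b` through the new vertices. -/
def pathToFun (a b : Z.V) (m : ℕ) (k : Fin (m + 2)) : Z.V ⊕ Fin m :=
  if h : (k : ℕ) = 0 then .inl a else if h' : (k : ℕ) = m + 1 then .inl b
  else .inr ⟨k - 1, by omega⟩

end gluePath

/-- The graph with two looped vertices and no other edges. -/
def twoLoops : FinGraph where
  V := Bool
  Adj := fun v w => v = w
  symm := fun h => h.symm

/-- The inclusion of the end points of the path `I n`. -/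
def endPoints (n : ℕ) : twoLoops ⟶ I n where
  toFun := fun v => bif v then Fin.last n else (0 : Fin (n + 1))
  map_adj := by
    rintro v _ rfl
    change |_| ≤ 1
    simp

/-! ### Gluing a path as a pushout -/

section PathPushout

variable {Z : FinGraph} (i : twoLoops ⟶ Z) (m : ℕ)

/-- The inclusion of `Z` into `Z` with a path glued to it. -/
def gluePathInl (a b : Z.V) : Z ⟶ Z.gluePath a b m where
  toFun := fun x => .inl x
  map_adj := fun h => h

/-- The path from `i false` to `i true` through the new vertices. -/
def gluePathPath (hm : 0 < m) : I (m + 1) ⟶ Z.gluePath (i.toFun false) (i.toFun true) m where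
  toFun := pathToFun (i.toFun false) (i.toFun true) m
  map_adj := by
    have hf : Z.Adj (i.toFun false) (i.toFun false) := i.map_adj rfl
    have ht : Z.Adj (i.toFun true) (i.toFun true) := i.map_adj rfl
    rintro ⟨k, hk⟩ ⟨l, hl⟩ (h : |(k : ℤ) - (l : ℤ)| ≤ 1)
    rw [abs_le] at h
    simp only [pathToFun]
    split_ifs <;> first | exact hf | exact ht | (exfalso; omega) | (simp only [true_and]; omega)

/-- The function on vertices underlying `gluePathDesc`. -/
def gluePathDescFun {X : FinGraph} (f : Z ⟶ X) (g : I (m + 1) ⟶ X) : Z.V ⊕ Fin m → X.V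
  | .inl x => f.toFun x
  | .inr j => g.toFun (⟨j + 1, by omega⟩ : Fin (m + 2))

/-- The map out of `Z` with a path glued to it that is given by maps out of `Z` and the path. -/
def gluePathDesc {X : FinGraph} (f : Z ⟶ X) (g : I (m + 1) ⟶ X)
    (w : i ≫ f = endPoints (m + 1) ≫ g) :
    Z.gluePath (i.toFun false) (i.toFun true) m ⟶ X where
  toFun := gluePathDescFun m f g
  map_adj := by
    have h0 : f.toFun (i.toFun false) = g.toFun (0 : Fin (m + 2)) :=
      congrArg (fun f : twoLoops ⟶ X => f.toFun false) w
    have h1 : f.toFun (i.toFun true) = g.toFun (Fin.last (m + 1)) :=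
      congrArg (fun f : twoLoops ⟶ X => f.toFun true) w
    have hlr : ∀ (x : Z.V) (j : Fin m),
        (x = i.toFun false ∧ (j : ℕ) = 0) ∨ (x = i.toFun true ∧ (j : ℕ) + 1 = m) →
        X.Adj (f.toFun x) (g.toFun (⟨j + 1, by omega⟩ : Fin (m + 2))) := by
      rintro x j (⟨rfl, hj⟩ | ⟨rfl, hj⟩)
      · rw [h0]
        refine g.map_adj ?_
        change |((0 : ℕ) : ℤ) - ((j + 1 : ℕ) : ℤ)| ≤ 1
        simp [hj]
      · rw [h1]
        refine g.map_adj ?_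
        change |((m + 1 : ℕ) : ℤ) - ((j + 1 : ℕ) : ℤ)| ≤ 1
        simp [hj]
    rintro (x | j) (y | k) h
    · exact f.map_adj h
    · exact hlr x k h
    · exact X.symm (hlr y j h)
    · refine g.map_adj ?_
      change |((j + 1 : ℕ) : ℤ) - ((k + 1 : ℕ) : ℤ)| ≤ 1
      rw [abs_le]
      have h : (j : ℕ) ≤ k + 1 ∧ (k : ℕ) ≤ j + 1 := h
      omega

/-- For `m = 0` the path would be a single edge from `a` to `b`, which `gluePath` does not add. -/
theorem isPushout_gluePath (hm : 0 < m) :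
    IsPushout i (endPoints (m + 1)) (gluePathInl m (i.toFun false) (i.toFun true))
      (gluePathPath i m hm) := by
  have w : i ≫ gluePathInl m (i.toFun false) (i.toFun true) =
      endPoints (m + 1) ≫ gluePathPath i m hm := by
    refine hom_ext ?_
    rintro (_ | _)
    · rfl
    · change _ = pathToFun (i.toFun false) (i.toFun true) m (Fin.last (m + 1))
      simp only [pathToFun, Fin.val_last, Nat.add_eq_zero_iff, one_ne_zero, and_false, dite_true,
        dite_false]
      rfl
  refine IsPushout.of_isColimit' ⟨w⟩ (PushoutCocone.IsColimit.mk w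
    (fun s => gluePathDesc i m s.inl s.inr s.condition) (fun s => rfl) ?_ ?_)
  · intro s
    have h0 := congrArg (fun f : twoLoops ⟶ s.pt => f.toFun false) s.condition
    have h1 := congrArg (fun f : twoLoops ⟶ s.pt => f.toFun true) s.condition
    refine hom_ext fun k => ?_
    obtain ⟨k, hk⟩ := k
    change gluePathDescFun _ _ _ (pathToFun (i.toFun false) (i.toFun true) m ⟨k, hk⟩) = _
    simp only [pathToFun]
    split_ifs with hk0 hkm
    · subst hk0
      exact h0
    · subst hkm
      exact h1
    · obtain ⟨k, rfl⟩ := Nat.exists_eq_succ_of_ne_zero hk0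
      rfl
  · intro s g hl hr
    refine hom_ext ?_
    rintro (x | ⟨j, hj⟩)
    · exact congrArg (fun f : Z ⟶ s.pt => f.toFun x) hl
    · have := congrArg (fun f : I (m + 1) ⟶ s.pt => f.toFun (⟨j + 1, by omega⟩ : Fin (m + 2))) hr
      refine Eq.trans (congrArg g.toFun ?_) this
      change _ = pathToFun (i.toFun false) (i.toFun true) m ⟨j + 1, _⟩
      simp [pathToFun, show j ≠ m by omega]
end PathPushout

/-! ### Contractible paths and the contradiction -/

/-- The one-vertex graph with a loop. -/
def loop : FinGraph where
  V := Unit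
  Adj := fun _ _ => True
  symm := fun h => h

/-- The map to the one-vertex graph with a loop. -/
def toLoop (A : FinGraph) : A ⟶ loop where
  toFun := fun _ => ()
  map_adj := fun _ => trivial

/-- The inclusion of the vertex `0` of `I n`. -/
def zeroVertex (n : ℕ) : loop ⟶ I n where
  toFun := fun _ => (0 : Fin (n + 1))
  map_adj := fun _ => show |((0 : ℕ) : ℤ) - ((0 : ℕ) : ℤ)| ≤ 1 by simp

/-- Truncating at height `l` by `min` contracts the path to its vertex `0`. -/
theorem xHomotopic_toLoop_zeroVertex (n : ℕ) :
    XHomotopic (toLoop (I n) ≫ zeroVertex n) (𝟙 (I n)) := by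
  refine ⟨n, { toFun := fun p => (min p.1 p.2 : Fin (n + 1)), map_adj := ?_ }, ?_, ?_⟩
  · rintro ⟨⟨k, hk⟩, ⟨l, hl⟩⟩ ⟨⟨k', hk'⟩, ⟨l', hl'⟩⟩
      ⟨h₁ : |(k : ℤ) - (k' : ℤ)| ≤ 1, h₂ : |(l : ℤ) - (l' : ℤ)| ≤ 1⟩
    change |(((min (⟨k, hk⟩ : Fin (n + 1)) ⟨l, hl⟩ : Fin (n + 1)) : ℕ) : ℤ) -
      (((min (⟨k', hk'⟩ : Fin (n + 1)) ⟨l', hl'⟩ : Fin (n + 1)) : ℕ) : ℤ)| ≤ 1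
    rw [abs_le] at h₁ h₂ ⊢
    simp only [Fin.coe_min]
    omega
  · intro a
    exact min_eq_right (Fin.zero_le (n := n + 1) a)
  · intro a
    exact min_eq_left (Fin.le_last (n := n) a)

/-- Any map between paths is a ×-homotopy equivalence. -/
theorem xHomotopyEquivalences_I {m n : ℕ} (f : I m ⟶ I n) : xHomotopyEquivalences f := by
  refine ⟨toLoop (I n) ≫ zeroVertex m, xHomotopic_toLoop_zeroVertex m, ?_⟩
  have h := (xHomotopic_toLoop_zeroVertex n)
  have h' := h.comp_left (toLoop (I n) ≫ zeroVertex m ≫ f)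
  have h'' : XHomotopic (toLoop (I n) ≫ zeroVertex n) ((toLoop (I n) ≫ zeroVertex m) ≫ f) := h'
  exact (xHomotopic_equivalence _ _).trans ((xHomotopic_equivalence _ _).symm h'') h

/-- The map that collapses the last edge of a path. -/
def collapse (n : ℕ) : I (n + 1) ⟶ I n where
  toFun := fun k : Fin (n + 2) => (⟨min k n, by omega⟩ : Fin (n + 1))
  map_adj := by
    rintro ⟨k, hk⟩ ⟨l, hl⟩ (h : |(k : ℤ) - (l : ℤ)| ≤ 1)
    change |((min k n : ℕ) : ℤ) - ((min l n : ℕ) : ℤ)| ≤ 1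
    rw [abs_le] at h ⊢
    omega

theorem endPoints_collapse (n : ℕ) : endPoints (n + 1) ≫ collapse n = endPoints n := by
  refine hom_ext ?_
  rintro (_ | _)
  · exact Fin.ext (Nat.zero_min n)
  · exact Fin.ext (Nat.min_eq_right (Nat.le_succ n))

/-- The collapse respects end points, so by pasting the map between the glued graphs is a cobase
change of it along a cofibration. -/
theorem xEquiv_gluePath {Cof : MorphismProperty FinGraph}
    (h : IsCofibrationCategory xHomotopyEquivalences Cof) {Z : FinGraph} {i : twoLoops ⟶ Z}
    (hi : Cof i) {m : ℕ} (hm : 0 < m) : XEquiv (Z.gluePath (i.toFun false) (i.toFun true) (m + 1))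
      (Z.gluePath (i.toFun false) (i.toFun true) m) := by
  have sq := isPushout_gluePath i (m + 1) m.succ_pos
  have sq' := isPushout_gluePath i m hm
  have w : i ≫ gluePathInl m (i.toFun false) (i.toFun true) =
      endPoints (m + 2) ≫ collapse (m + 1) ≫ gluePathPath i m hm := by
    rw [← Category.assoc, endPoints_collapse, sq'.w]
  have t : IsPushout (gluePathPath i (m + 1) m.succ_pos) (collapse (m + 1)) (sq.desc _ _ w)
      (gluePathPath i m hm) := by
    refine (IsPushout.of_left ?_ (by simp) sq.flip).flip
    rw [endPoints_collapse, sq.inl_desc]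
    exact sq'.flip
  exact ⟨_, h.weq_inl (h.cof_inr sq hi) (xHomotopyEquivalences_I _) t⟩

/-- At a looped vertex each step moves the image along an edge. -/
theorem XHomotopic.reflTransGen_adj {A B : FinGraph} {f g : A ⟶ B} (h : XHomotopic f g) {v : A.V}
    (hv : A.Adj v v) : Relation.ReflTransGen B.Adj (f.toFun v) (g.toFun v) := by
  rw [xHomotopic_iff] at h
  exact h.lift (fun f => f.toFun v) fun f f' (hs : Step f f') => hs v v hv

theorem reflTransGen_adj_of_xEquiv_loop {A : FinGraph} (h : XEquiv A loop) {v w : A.V}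
    (hv : A.Adj v v) (hw : A.Adj w w) : Relation.ReflTransGen A.Adj v w := by
  obtain ⟨f, g, h, -⟩ := h
  exact (((xHomotopic_equivalence _ _).symm h).reflTransGen_adj hv).trans (h.reflTransGen_adj hw)

theorem eq_or_exists_adj_ne_of_reflTransGen {A : FinGraph} {v w : A.V}
    (h : Relation.ReflTransGen A.Adj v w) : v = w ∨ ∃ c, c ≠ v ∧ A.Adj v c := by
  induction h with
  | refl => exact .inl rfl
  | @tail x y _ hxy ih =>
    by_cases hvy : v = y
    · exact .inl hvy
    · rcases ih with rfl | h
      · exact .inr ⟨y, Ne.symm hvy, hxy⟩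
      · exact .inr h

theorem not_isCofibrationCategory (Cof : MorphismProperty FinGraph) :
    ¬ IsCofibrationCategory xHomotopyEquivalences Cof := by
  intro h
  obtain ⟨Z, i, p, hi, hp, -⟩ := h.factorization (toLoop twoLoops)
  set a := i.toFun false
  set b := i.toFun true
  have haa : Z.Adj a a := i.map_adj rfl
  have hbb : Z.Adj b b := i.map_adj rfl
  obtain ⟨T, hKT, hred, hT⟩ := exists_reduction {a, b} (Set.univ : Set Z.V) (Set.subset_univ _)
  have haT : a ∈ T := hKT (by simp)
  have hbT : b ∈ T := hKT (by simp)
  have hTl : XEquiv (Z.induce T) loop :=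
    (FoldStepRel.xEquiv hred).symm.trans ((xEquiv_induce_univ Z).symm.trans ⟨p, hp⟩)
  -- `T` is equivalent to a loop, so its looped vertices are connected in `T`. Thus `a` and `b`
  -- either coincide or each have another neighbour in `T`.
  have key : ∀ x y : T, Z.Adj x x → Z.Adj y y →
      (x : Z.V) = y ∨ ∃ c ∈ T, c ≠ (x : Z.V) ∧ Z.Adj x c := by
    intro x y hx hy
    rcases eq_or_exists_adj_ne_of_reflTransGen
      (reflTransGen_adj_of_xEquiv_loop hTl (v := x) (w := y) hx hy) with h | ⟨c, hc, hadj⟩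
    · exact .inl (congrArg Subtype.val h)
    · exact .inr ⟨c.1, c.2, fun e => hc (Subtype.ext e), hadj⟩
  have hstiff : ∀ m, 3 ≤ m → (Z.gluePath a b m).IsStiffOn (withPath T m) := fun m hm =>
    isStiffOn_withPath hm haT hbT haa hbb hT (key ⟨a, haT⟩ ⟨b, hbT⟩ haa hbb)
      ((key ⟨b, hbT⟩ ⟨a, haT⟩ hbb haa).imp_left Eq.symm)
  have hequiv : ∀ m, XEquiv (Z.gluePath a b m) ((Z.gluePath a b m).induce (withPath T m)) := by
    intro m
    have e : (withPath (Set.univ : Set Z.V) m : Set (Z.gluePath a b m).V) = Set.univ := by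
      ext (x | j) <;> simp
    have r := FoldStepRel.xEquiv (hred.lift (p := FoldStepRel (Z := Z.gluePath a b m) {.inl a, .inl b})
      (fun S => withPath S m) fun S S' hs => FoldStepRel.withPath hs m)
    simp only [e] at r
    exact (xEquiv_induce_univ _).trans r
  have hc := (((hequiv 4).symm.trans (xEquiv_gluePath h hi (m := 3) (by norm_num))).trans (hequiv 3)).card_eq
    (isStiff_induce (hstiff 4 (by norm_num))) (isStiff_induce (hstiff 3 (by norm_num)))
  change Nat.card (withPath T 4) = Nat.card (withPath T 3) at hc
  rw [card_withPath, card_withPath] at hc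
  omega

end FinGraph
theorem mainTheorem1 :
    (¬ ∃ Cof : MorphismProperty FinGraph,
      IsCofibrationCategory FinGraph.xHomotopyEquivalences Cof) ∧
    (∀ Cof : MorphismProperty FinGraph,
      IsCofibrationCategory FinGraph.xHomotopyEquivalences Cof →
        Cof ≤ FinGraph.quasiCofibrations) ∧
    (∀ A B : FinGraph, A.IsStiff → B.IsStiff → Nat.card B.V < Nat.card A.V →
      ∀ h : A ⟶ B, ¬ ∃ (B' : FinGraph) (f : A ⟶ B') (g : B' ⟶ B),
        FinGraph.quasiCofibrations f ∧ FinGraph.xHomotopyEquivalences g ∧ f ≫ g = h) ∧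
    (FinGraph.C6.IsStiff ∧ FinGraph.K2.IsStiff ∧ Nonempty (FinGraph.C6 ⟶ FinGraph.K2) ∧
      ∀ h : FinGraph.C6 ⟶ FinGraph.K2,
        ¬ ∃ (B' : FinGraph) (f : FinGraph.C6 ⟶ B') (g : B' ⟶ FinGraph.K2),
          FinGraph.quasiCofibrations f ∧ FinGraph.xHomotopyEquivalences g ∧ f ≫ g = h) := by
  have hnot := FinGraph.not_isCofibrationCategory
  have hfactor := @FinGraph.not_exists_quasiCofibration_factorization
  have hC6 := FinGraph.isStiff_C6
  have hK2 := FinGraph.isStiff_K2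
  refine ⟨fun ⟨Cof, h⟩ => hnot Cof h, fun Cof h => absurd h (hnot Cof),
    fun A B hA hB hcard h => hfactor hA hB hcard h, hC6, hK2, FinGraph.nonempty_hom_C6_K2,
    fun h => hfactor hC6 hK2 ?_ h⟩
  change Nat.card (Fin 2) < Nat.card (Fin 6)
  simp
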